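/- **Setting.** Fix $r>0$ (robot radius), $d>0$ (inter-wheel distance), $s>0$ (maximal wheel speed) and $\rho\ge 0$ (padding). A system of $n$ robots has states $x=(p_i,\theta_i)_{i=1}^n\in(\mathbb R^2\times S^1)^n$. The state is *free* if $\|p_i-p_j\|\ge 2r$ for all $i\neq j$, and *aggregated* if it is free and $\bigcup_{i}\overline{D}_{r+\rho}(p_i)$ is connected. Robot $i$ *sees another robot* if the infinite ray from $p_i$ in direction $h(\theta_i)=(\cos\theta_i,\sin\theta_i)$ meets the closed disc $\overline D_r(p_j)$ for some $j\ne i$. A *bimodal controller* is a vector $u=(v_{l,0},v_{r,0},v_{l,1},v_{r,1})\in[-1,1]^4$; mode $m\in\{0,1\}$ commands the tangential speed and angular velocity $$c_m=(v,\omega)=\Bigl(\tfrac{s(v_{l,m}+v_{r,m})}{2},\ \tfrac{s(v_{r,m}-v_{l,m})}{d}\Bigr).$$ All robots use the same $u$: mode $1$ while another robot is seen, mode $0$ otherwise. A *trajectory* of $u$ from a free state $x_0$ is a curve $\gamma:[0,\infty)\to(\mathbb R^2\times S^1)^n$ of free states with $\gamma(0)=x_0$, for which there are measurable functions $w_i,k_i:[0,\infty)\to[0,1]$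 such that, with $(v_i,\omega_i)=(1-w_i)c_0+w_ic_1$, every robot satisfies (in integrated form) $$\dot p_i=k_i v_i\,h(\theta_i),\qquad \dot\theta_i=k_i\omega_i ,$$ where * (sensing) $w_i(t)$ is the sensor reading ($1$ if robot $i$ sees another robot, $0$ if not) whenever this reading is constant on a neighbourhood of $\gamma(t)$ in the set of free states; at discontinuities of the sensor it is any number in $[0,1]$ (Filippov solutions); * (collisions without pushing or slippage) $k_i(t)=1$ unless robot $i$ is *blocked* at time $t$, that is, it touches some robot $j$ ($\|p_i-p_j\|=2r$) and moving with the constant commanded $(v_i,\omega_i)$ would bring its centre, at arbitrarily small positive times, to distance less than $2r$ from the present centre of $j$. **Theorem.** For every bimodal controller $u$ there are a number of robots $n_u\ge 2$ and a free initial state $x_0$ of $n_u$ robots from which the system never aggregates: there is a trajectory of $u$ from $x_0$, and for every trajectory $\gamma$ of $u$ from $x_0$ and every $t\ge 0$ the state $\gamma(t)$ is not aggregated. Consequently, there is no bimodal controller $u$ such that for every $n\ge 2$ and every free initial state $x_0$ of $n$ robots some trajectory of $u$ from $x_0$ reaches an aggregated state. -/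

import Mathlib

open Set Filter Topology

noncomputable section

/-- The plane with its Euclidean norm. -/
abbrev Plane : Type := EuclideanSpace ℝ (Fin 2)

/-- The state of one robot: the position of its centre and its orientation, in `ℝ² × S¹`. -/
abbrev RobotState : Type := Plane × Real.Angle

/-- The physical constants of the homogeneous disc-shaped differential-drive robots, and the
padding used in the definition of aggregation. -/
structure RobotModel where
  /-- radius `r` of every robot -/
  radius : ℝ
  /-- inter-wheel distance -/
  wheelDist : ℝ
  /-- maximal wheel speed, by which the controls are normalized -/
  maxSpeed : ℝ
  /-- padding parameter `ρ` of the aggregation condition -/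
  padding : ℝ
  radius_pos : 0 < radius
  wheelDist_pos : 0 < wheelDist
  maxSpeed_pos : 0 < maxSpeed
  padding_nonneg : 0 ≤ padding

/-- The space of bimodal controllers: vectors `(v_{l,0}, v_{r,0}, v_{l,1}, v_{r,1})` of normalized
wheel speeds, the first two used when no robot is in sight, the last two otherwise. -/
def controllers : Set (Fin 4 → ℝ) := {u | ∀ k, u k ∈ Icc (-1 : ℝ) 1}

/-- The unit vector of orientation `θ`. -/
def heading (θ : Real.Angle) : Plane := !₂[θ.cos, θ.sin]

/-- Free states of `n` robots: distinct robots have centres at distance at least `2r`. -/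
def freeSpace (P : RobotModel) (n : ℕ) : Set (Fin n → RobotState) :=
  {x | ∀ i j, i ≠ j → 2 * P.radius ≤ dist (x i).1 (x j).1}

/-- Aggregated states: free states for which the union of the closed discs of radius `r + ρ`
about the centres is connected. -/
def aggregated (P : RobotModel) (n : ℕ) : Set (Fin n → RobotState) :=
  {x | x ∈ freeSpace P n ∧
    IsConnected (⋃ i, Metric.closedBall (x i).1 (P.radius + P.padding))}

/-- The binary sensor of robot `i` reads `1`: the infinite ray from its centre along its
orientation meets the (closed) disc of another robot. -/
def Sees (P : RobotModel) {n : ℕ} (x : Fin n → RobotState) (i : Fin n) : Prop :=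
  ∃ j, j ≠ i ∧ ∃ s : ℝ, 0 ≤ s ∧
    dist ((x i).1 + s • heading (x i).2) (x j).1 ≤ P.radius

/-- Tangential speed `v` and angular velocity `ω` produced by normalized wheel controls
`(wl, wr)`. -/
def twist (P : RobotModel) (wl wr : ℝ) : ℝ × ℝ :=
  ((P.maxSpeed * wl + P.maxSpeed * wr) / 2, (P.maxSpeed * wr - P.maxSpeed * wl) / P.wheelDist)

/-- The commanded `(v, ω)` for sensor weight `w`: the no-robot-in-sight command for `w = 0`, the
robot-in-sight command for `w = 1`. Values of `w` strictly between are used only where the sensor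
reading is discontinuous. -/
def command (P : RobotModel) (u : Fin 4 → ℝ) (w : ℝ) : ℝ × ℝ :=
  (1 - w) • twist P (u 0) (u 1) + w • twist P (u 2) (u 3)

/-- The position after time `s` of an unobstructed robot that starts in state `q` and moves with
constant tangential speed `c.1` and constant angular velocity `c.2`. -/
def freeMotion (q : RobotState) (c : ℝ × ℝ) (s : ℝ) : Plane :=
  q.1 + ∫ τ in (0 : ℝ)..s, c.1 • heading (q.2 + ((c.2 * τ : ℝ) : Real.Angle))

/-- In state `x`, robot `i`, commanded to move with `c = (v, ω)`, is blocked: it touches another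
robot `j`, and executing the command would immediately make it overlap the present disc of `j`. -/
def Blocked (P : RobotModel) {n : ℕ} (x : Fin n → RobotState) (i : Fin n) (c : ℝ × ℝ) : Prop :=
  ∃ j, j ≠ i ∧ dist (x i).1 (x j).1 = 2 * P.radius ∧
    ∃ᶠ s in 𝓝[>] (0 : ℝ), dist (freeMotion (x i) c s) (x j).1 < 2 * P.radius

/-- `γ` is a trajectory (on `[0, ∞)`) of `n` robots under the controller `u` from `x₀`.

Robots never overlap. Robot `i` obeys the unicycle equations
`ẋ = k v cos θ`, `ẏ = k v sin θ`, `θ̇ = k ω` (in integrated form, that is, for almost every time)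
with the commanded `(v, ω)`, where `k ∈ [0, 1]` is its rate of progress along the commanded motion:
`k = 1` unless the robot is blocked by another one. Robots do not push each other, so a robot
pressed against another one can only progress as far as the other leaves room, and stands still
(also rotationally, as there is no slippage) if there is none.

The sensor is discontinuous in the state, so solutions are understood in the sense of Filippov:
the sensor weight `w` is the sensor reading wherever this reading is locally constant on the free
space, and is any number in `[0, 1]` elsewhere. Since `w` and `k` are measurable and bounded, the
integrands below are integrable on bounded intervals. -/
structure IsTrajectory (P : RobotModel) (u : Fin 4 → ℝ) {n : ℕ} (x₀ : Fin n → RobotState)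
    (γ : ℝ → Fin n → RobotState) : Prop where
  start : γ 0 = x₀
  free : ∀ t, 0 ≤ t → γ t ∈ freeSpace P n
  motion : ∃ w k : ℝ → Fin n → ℝ, ∀ i,
    Measurable (fun t => w t i) ∧ Measurable (fun t => k t i) ∧
    (∀ t, 0 ≤ t →
      w t i ∈ Icc (0 : ℝ) 1 ∧
      ((∀ᶠ y in 𝓝[freeSpace P n] (γ t), Sees P y i) → w t i = 1) ∧
      ((∀ᶠ y in 𝓝[freeSpace P n] (γ t), ¬ Sees P y i) → w t i = 0) ∧
      k t i ∈ Icc (0 : ℝ) 1 ∧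
      (k t i < 1 → Blocked P (γ t) i (command P u (w t i)))) ∧
    (∀ t, 0 ≤ t →
      (γ t i).1 = (x₀ i).1 +
        ∫ s in (0 : ℝ)..t, (k s i * (command P u (w s i)).1) • heading (γ s i).2) ∧
    (∀ t, 0 ≤ t →
      (γ t i).2 = (x₀ i).2 +
        ((∫ s in (0 : ℝ)..t, k s i * (command P u (w s i)).2 : ℝ) : Real.Angle))

end

/-! Either the robots can be jammed, or their centres never move.

If the tangential speed is nonzero in some mode `c`, four robots are placed at the corners of a
rectangle: two touching pairs, far apart. A nearly horizontal heading, towards the other pair for `c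
= 1` and away from it for `c = 0`, makes every sensor robustly read `c`. A small vertical tilt, its
sign matched to that of the speed, makes both members of each pair press against each other.
Standing still is then a trajectory, since all robots are blocked
(`isTrajectory_const_of_deadlock`). It is also the only one (`IsTrajectory.eq_of_deadlock`),
although a blocked robot may have any rate of progress in `[0, 1]`: progress would shorten the
distance within a pair to first order and could lengthen it only to second order, so the discs would
overlap (`progress_eq_zero`).

If the tangential speed vanishes in both modes, no trajectory moves a centre, and two distant robots
never aggregate. What remains is the existence of a trajectory (`exists_isTrajectory_pairState`): a
Filippov equilibrium at the edge of sight if the two turning rates do not have the same strict sign,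
and otherwise a rotation that obeys the sensor. -/

/-! ### Commands, headings and plane coordinates -/

theorem command_fst (P : RobotModel) (u : Fin 4 → ℝ) (w : ℝ) :
    (command P u w).1 = (1 - w) * (twist P (u 0) (u 1)).1 + w * (twist P (u 2) (u 3)).1 := by
  simp [command]

theorem command_snd (P : RobotModel) (u : Fin 4 → ℝ) (w : ℝ) :
    (command P u w).2 = (1 - w) * (twist P (u 0) (u 1)).2 + w * (twist P (u 2) (u 3)).2 := by
  simp [command]

theorem continuous_command (P : RobotModel) (u : Fin 4 → ℝ) : Continuous (command P u) := by
  unfold command; fun_prop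

theorem continuous_heading : Continuous heading := by
  unfold heading
  refine (PiLp.continuous_toLp 2 _).comp (continuous_pi fun k => ?_)
  fin_cases k
  · exact Real.Angle.continuous_cos
  · exact Real.Angle.continuous_sin

@[simp]
theorem norm_heading (θ : Real.Angle) : ‖heading θ‖ = 1 := by
  simp [heading, EuclideanSpace.norm_eq, Fin.sum_univ_two]

theorem plane_inner (x y : Plane) : inner ℝ x y = x 0 * y 0 + x 1 * y 1 := by
  simp [PiLp.inner_apply, Fin.sum_univ_two, mul_comm]

theorem plane_dist_sq (x y : Plane) : dist x y ^ 2 = (x 0 - y 0) ^ 2 + (x 1 - y 1) ^ 2 := by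
  rw [EuclideanSpace.dist_eq, Real.sq_sqrt (Finset.sum_nonneg fun _ _ => sq_nonneg _)]
  simp [Fin.sum_univ_two, Real.dist_eq]

/-! ### Blocking, non-aggregation and robust sensing -/

/-- The unobstructed motion has the commanded velocity at the start. -/
theorem hasDerivAt_freeMotion (q : RobotState) (c : ℝ × ℝ) :
    HasDerivAt (freeMotion q c) (c.1 • heading q.2) 0 := by
  have hc : Continuous fun τ : ℝ => c.1 • heading (q.2 + ((c.2 * τ : ℝ) : Real.Angle)) := by
    have h : Continuous fun τ : ℝ => q.2 + ((c.2 * τ : ℝ) : Real.Angle) :=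
      continuous_const.add (Real.Angle.continuous_coe.comp (continuous_const.mul continuous_id))
    exact (continuous_heading.comp h).const_smul c.1
  have := (hc.integral_hasStrictDerivAt 0 0).hasDerivAt.const_add q.1
  simp only [mul_zero, Real.Angle.coe_zero, add_zero] at this
  exact this

/-- A robot that touches another one and is commanded to move with positive speed towards it is
blocked. -/
theorem blocked_of_inner_pos (P : RobotModel) {n : ℕ} (x : Fin n → RobotState) {i j : Fin n}
    (c : ℝ × ℝ) (hji : j ≠ i) (hd : dist (x i).1 (x j).1 = 2 * P.radius)
    (hc : 0 < c.1 * inner ℝ (heading (x i).2) ((x j).1 - (x i).1)) : Blocked P x i c := by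
  refine ⟨j, hji, hd, Eventually.frequently ?_⟩
  -- The squared distance to the present centre of `j` has negative derivative at time 0, hence is
  -- below its initial value at all small positive times.
  have h1 := ((hasDerivAt_freeMotion (x i) c).sub_const (x j).1).norm_sq
  have h0 : freeMotion (x i) c 0 = (x i).1 := by simp [freeMotion]
  have hneg : 2 * inner ℝ (freeMotion (x i) c 0 - (x j).1) (c.1 • heading (x i).2) < 0 := by
    rw [h0, inner_smul_right, real_inner_comm, ← neg_sub, inner_neg_right]
    linarith
  have h2 := h1.tendsto_slope_zero_right.eventually (gt_mem_nhds hneg)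
  filter_upwards [h2, self_mem_nhdsWithin] with s hs hs0
  have hs0 : 0 < s := hs0
  simp only [zero_add, smul_eq_mul, h0] at hs
  have h3 : ‖freeMotion (x i) c s - (x j).1‖ ^ 2 - ‖(x i).1 - (x j).1‖ ^ 2 < 0 := by
    by_contra! h
    exact absurd hs (not_lt.2 (mul_nonneg (inv_pos.2 hs0).le h))
  rw [← dist_eq_norm, ← dist_eq_norm, hd] at h3
  exact lt_of_pow_lt_pow_left₀ 2 (by have := P.radius_pos; positivity) (by linarith)

/-- A state whose robot centres leave a wide gap in some coordinate is not aggregated. -/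
theorem not_mem_aggregated_of_gap (P : RobotModel) {n : ℕ} (x : Fin n → RobotState) (k : Fin 2)
    (a : ℝ) (hgap : ∀ i, P.radius + P.padding < |(x i).1 k - a|) {i j : Fin n}
    (hi : (x i).1 k < a) (hj : a < (x j).1 k) : x ∉ aggregated P n := by
  rintro ⟨-, -, hconn⟩
  have hR : 0 ≤ P.radius + P.padding := add_nonneg P.radius_pos.le P.padding_nonneg
  have hf : Continuous fun p : Plane => p k := by fun_prop
  have him := hconn.image _ hf.continuousOn
  have hmem : ∀ i, (x i).1 k ∈ (fun p : Plane => p k) ''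
      ⋃ i, Metric.closedBall (x i).1 (P.radius + P.padding) := fun i =>
    ⟨_, mem_iUnion.2 ⟨i, Metric.mem_closedBall_self hR⟩, rfl⟩
  -- The `k`-th coordinates of a connected union form an interval, so some disc would contain a
  -- point of coordinate `a`; its centre would then violate the gap.
  obtain ⟨p, hp, hpa⟩ := him.Icc_subset (hmem i) (hmem j) ⟨hi.le, hj.le⟩
  obtain ⟨l, hl⟩ := mem_iUnion.1 hp
  have h1 : |(p - (x l).1) k| ≤ ‖p - (x l).1‖ := PiLp.norm_apply_le (p - (x l).1) k
  rw [← dist_eq_norm] at h1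
  have h2 := hgap l
  simp only at hpa
  rw [PiLp.sub_apply, hpa, abs_sub_comm] at h1
  exact absurd (h1.trans (Metric.mem_closedBall.1 hl)) (not_le.2 h2)

/-- A robot whose ray passes through the interior of another disc sees robustly. -/
theorem eventually_sees (P : RobotModel) {n : ℕ} (x : Fin n → RobotState) {i j : Fin n}
    (hji : j ≠ i) {s : ℝ} (hs : 0 ≤ s)
    (hd : dist ((x i).1 + s • heading (x i).2) (x j).1 < P.radius) :
    ∀ᶠ y in 𝓝 x, Sees P y i := by
  have hc : Continuous fun y : Fin n → RobotState =>
      dist ((y i).1 + s • heading (y i).2) (y j).1 := by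
    have := continuous_heading
    fun_prop
  filter_upwards [hc.continuousAt.eventually (gt_mem_nhds hd)] with y hy
  exact ⟨j, hji, s, hs, hy.le⟩

/-- A robot that looks away from all the others, in the sense that a linear functional separates
its ray from their discs, robustly sees nothing. -/
theorem eventually_not_sees (P : RobotModel) {n : ℕ} (x : Fin n → RobotState) {i : Fin n}
    (e : Plane) (he : 0 < inner ℝ (heading (x i).2) e)
    (hd : ∀ j, j ≠ i → P.radius * ‖e‖ < inner ℝ ((x i).1 - (x j).1) e) :
    ∀ᶠ y in 𝓝 x, ¬ Sees P y i := by
  have hh := continuous_heading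
  have hc1 : Continuous fun y : Fin n → RobotState => inner ℝ (heading (y i).2) e := by fun_prop
  have h1 := hc1.continuousAt.eventually (lt_mem_nhds he)
  have h2 : ∀ᶠ y in 𝓝 x, ∀ j, j ≠ i → P.radius * ‖e‖ < inner ℝ ((y i).1 - (y j).1) e := by
    refine eventually_all.2 fun j => eventually_all.2 fun hj => ?_
    have hc2 : Continuous fun y : Fin n → RobotState => inner ℝ ((y i).1 - (y j).1) e := by
      fun_prop
    exact hc2.continuousAt.eventually (lt_mem_nhds (hd j hj))
  filter_upwards [h1, h2] with y hy1 hy2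
  rintro ⟨j, hj, s, hs, hd⟩
  have h3 := real_inner_le_norm ((y i).1 + s • heading (y i).2 - (y j).1) e
  rw [← dist_eq_norm] at h3
  have h4 := mul_le_mul_of_nonneg_right hd (norm_nonneg e)
  have h5 : inner ℝ ((y i).1 + s • heading (y i).2 - (y j).1) e
      = inner ℝ ((y i).1 - (y j).1) e + s * inner ℝ (heading (y i).2) e := by
    rw [add_sub_right_comm, inner_add_left, real_inner_smul_left]
  have h6 := mul_nonneg hs hy1.le
  have h7 := hy2 j hj
  linarith

/-! ### Integrated motion of a single robot -/

/-- On bounded time intervals in `[0, ∞)`, the commanded rates are integrable. -/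
theorem intervalIntegrable_rate {f : ℝ × ℝ → ℝ} (hf : Continuous f) (P : RobotModel)
    (u : Fin 4 → ℝ) {w k : ℝ → ℝ} (hw : Measurable w) (hk : Measurable k)
    (hw1 : ∀ t, 0 ≤ t → w t ∈ Icc (0 : ℝ) 1) (hk1 : ∀ t, 0 ≤ t → k t ∈ Icc (0 : ℝ) 1) {a b : ℝ}
    (ha : 0 ≤ a) (hb : 0 ≤ b) :
    IntervalIntegrable (fun s => k s * f (command P u (w s))) MeasureTheory.volume a b := by
  have hc : Continuous fun w => f (command P u w) := hf.comp (continuous_command P u)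
  obtain ⟨M, hM⟩ := (isCompact_Icc (a := (0 : ℝ)) (b := 1)).exists_bound_of_continuousOn
    hc.continuousOn
  refine (intervalIntegrable_iff).2 (MeasureTheory.Measure.integrableOn_of_bounded
    (M := M) (by simp) ?_ ?_)
  · exact (hk.mul (hc.measurable.comp hw)).aestronglyMeasurable
  · refine (MeasureTheory.ae_restrict_mem measurableSet_uIoc).mono fun s hs => ?_
    have h0 : 0 ≤ s := (le_min ha hb).trans hs.1.le
    rw [norm_mul, Real.norm_of_nonneg (hk1 s h0).1]
    exact (mul_le_of_le_one_left (norm_nonneg _) (hk1 s h0).2).trans (hM _ (hw1 s h0))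

theorem continuousOn_primitive_of_intervalIntegrable {E : Type*} [NormedAddCommGroup E]
    [NormedSpace ℝ E] {f : ℝ → E} {b : ℝ} (hb : 0 ≤ b)
    (hf : IntervalIntegrable f MeasureTheory.volume 0 b) :
    ContinuousOn (fun t => ∫ s in (0 : ℝ)..t, f s) (Icc 0 b) := by
  have := intervalIntegral.continuousOn_primitive_interval
    ((intervalIntegrable_iff' (by simp)).1 hf)
  rwa [uIcc_of_le hb] at this

/-- A unit direction field that is continuous in time, run through at an integrable speed, has
integrable velocity. -/
theorem intervalIntegrable_smul_heading {f : ℝ → ℝ} {θ : ℝ → Real.Angle} {a b : ℝ}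
    (hf : IntervalIntegrable f MeasureTheory.volume a b) (hθ : ContinuousOn θ (uIcc a b)) :
    IntervalIntegrable (fun s => f s • heading (θ s)) MeasureTheory.volume a b :=
  hf.smul_continuousOn (continuous_heading.comp_continuousOn hθ)

/-- Data of a trajectory: sensor weights and rates of progress of one robot, with the integrated
equations of motion. -/
structure IsMotion (P : RobotModel) (u : Fin 4 → ℝ) (q : RobotState) (γ : ℝ → RobotState)
    (w k : ℝ → ℝ) : Prop where
  measurable_weight : Measurable w
  measurable_rate : Measurable k
  weight_mem : ∀ t, 0 ≤ t → w t ∈ Icc (0 : ℝ) 1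
  rate_mem : ∀ t, 0 ≤ t → k t ∈ Icc (0 : ℝ) 1
  position : ∀ t, 0 ≤ t → (γ t).1 = q.1 +
    ∫ s in (0 : ℝ)..t, (k s * (command P u (w s)).1) • heading (γ s).2
  orientation : ∀ t, 0 ≤ t → (γ t).2 = q.2 +
    ((∫ s in (0 : ℝ)..t, k s * (command P u (w s)).2 : ℝ) : Real.Angle)

namespace IsMotion

variable {P : RobotModel} {u : Fin 4 → ℝ} {q : RobotState} {γ : ℝ → RobotState} {w k : ℝ → ℝ}

theorem intervalIntegrable_fst (h : IsMotion P u q γ w k) {a b : ℝ} (ha : 0 ≤ a) (hb : 0 ≤ b) :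
    IntervalIntegrable (fun s => k s * (command P u (w s)).1) MeasureTheory.volume a b :=
  intervalIntegrable_rate continuous_fst P u h.1 h.2 h.3 h.4 ha hb

theorem intervalIntegrable_snd (h : IsMotion P u q γ w k) {a b : ℝ} (ha : 0 ≤ a) (hb : 0 ≤ b) :
    IntervalIntegrable (fun s => k s * (command P u (w s)).2) MeasureTheory.volume a b :=
  intervalIntegrable_rate continuous_snd P u h.1 h.2 h.3 h.4 ha hb

theorem intervalIntegrable_progress (h : IsMotion P u q γ w k) {a b : ℝ} (ha : 0 ≤ a)
    (hb : 0 ≤ b) : IntervalIntegrable k MeasureTheory.volume a b := by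
  simpa using intervalIntegrable_rate (f := fun _ => 1) continuous_const P u h.1 h.2 h.3 h.4 ha hb

/-- Comes before the position: the velocity is integrable because its direction is continuous in
time. -/
theorem continuousOn_orientation (h : IsMotion P u q γ w k) {b : ℝ} (hb : 0 ≤ b) :
    ContinuousOn (fun t => (γ t).2) (Icc 0 b) := by
  have h1 := continuousOn_primitive_of_intervalIntegrable hb
    (h.intervalIntegrable_snd le_rfl hb)
  exact ContinuousOn.congr ((continuousOn_const (c := q.2)).add
    (Real.Angle.continuous_coe.comp_continuousOn h1)) fun t ht => h.orientation t ht.1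

theorem intervalIntegrable_velocity (h : IsMotion P u q γ w k) {a b : ℝ} (ha : 0 ≤ a)
    (hb : 0 ≤ b) : IntervalIntegrable
      (fun s => (k s * (command P u (w s)).1) • heading (γ s).2) MeasureTheory.volume a b := by
  exact intervalIntegrable_smul_heading (h.intervalIntegrable_fst ha hb)
    ((h.continuousOn_orientation (b := max a b) (le_max_of_le_left ha)).mono
      (Icc_subset_Icc_left (le_min ha hb)))

theorem continuousOn (h : IsMotion P u q γ w k) {b : ℝ} (hb : 0 ≤ b) :
    ContinuousOn γ (Icc 0 b) := by
  have h1 := continuousOn_primitive_of_intervalIntegrable hb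
    (h.intervalIntegrable_velocity le_rfl hb)
  have h2 : ContinuousOn (fun t => (γ t).1) (Icc 0 b) :=
    ContinuousOn.congr (continuousOn_const.add h1) fun t ht => h.position t ht.1
  exact h2.prodMk (h.continuousOn_orientation hb)

theorem position_sub (h : IsMotion P u q γ w k) {a b : ℝ} (ha : 0 ≤ a) (hb : 0 ≤ b) :
    (γ b).1 - (γ a).1 = ∫ s in a..b, (k s * (command P u (w s)).1) • heading (γ s).2 := by
  rw [h.position a ha, h.position b hb, add_sub_add_left_eq_sub,
    intervalIntegral.integral_interval_sub_left (h.intervalIntegrable_velocity le_rfl hb)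
      (h.intervalIntegrable_velocity le_rfl ha)]

theorem orientation_sub (h : IsMotion P u q γ w k) {a b : ℝ} (ha : 0 ≤ a) (hb : 0 ≤ b) :
    (γ b).2 = (γ a).2 + ((∫ s in a..b, k s * (command P u (w s)).2 : ℝ) : Real.Angle) := by
  rw [h.orientation a ha, h.orientation b hb,
    ← intervalIntegral.integral_add_adjacent_intervals (h.intervalIntegrable_snd le_rfl ha)
      (h.intervalIntegrable_snd ha hb), Real.Angle.coe_add, add_assoc]

/-- While the weight is constant, the displacement is bounded by speed times total progress. -/
theorem norm_position_sub_le (h : IsMotion P u q γ w k) {a b c : ℝ} (ha : 0 ≤ a) (hab : a ≤ b)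
    (hw : ∀ s ∈ Icc a b, w s = c) :
    ‖(γ b).1 - (γ a).1‖ ≤ |(command P u c).1| * ∫ s in a..b, k s := by
  have hb := ha.trans hab
  rw [h.position_sub ha hb, ← intervalIntegral.integral_const_mul]
  refine intervalIntegral.norm_integral_le_of_norm_le hab (.of_forall fun s hs => ?_)
    ((h.intervalIntegrable_progress ha hb).const_mul _)
  rw [norm_smul, norm_heading, mul_one, hw s (Ioc_subset_Icc_self hs), norm_mul, mul_comm,
    Real.norm_of_nonneg (h.rate_mem s (ha.trans hs.1.le)).1, Real.norm_eq_abs]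

/-- While the weight is constant and the velocity has a component of at least `m` along `e`, so
has the displacement per progress. -/
theorem le_inner_position_sub (h : IsMotion P u q γ w k) {a b c m : ℝ} {e : Plane} (ha : 0 ≤ a)
    (hab : a ≤ b) (hw : ∀ s ∈ Icc a b, w s = c)
    (hm : ∀ s ∈ Icc a b, m ≤ (command P u c).1 * inner ℝ (heading (γ s).2) e) :
    m * ∫ s in a..b, k s ≤ inner ℝ e ((γ b).1 - (γ a).1) := by
  have hb := ha.trans hab
  have hv := h.intervalIntegrable_velocity ha hb
  have hi : inner ℝ e ((γ b).1 - (γ a).1) = ∫ s in a..b, inner ℝ e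
      ((k s * (command P u (w s)).1) • heading (γ s).2) := by
    rw [h.position_sub ha hb, intervalIntegral.integral_of_le hab,
      intervalIntegral.integral_of_le hab, integral_inner hv.1]
  rw [hi, ← intervalIntegral.integral_const_mul]
  refine intervalIntegral.integral_mono_on hab
    ((h.intervalIntegrable_progress ha hb).const_mul _) ?_ fun s hs => ?_
  · refine (intervalIntegrable_iff_integrableOn_Ioc_of_le hab).2 ?_
    exact MeasureTheory.Integrable.const_inner e hv.1
  · rw [inner_smul_right, real_inner_comm, hw s hs, mul_assoc, mul_comm m]
    exact mul_le_mul_of_nonneg_left (hm s hs) (h.rate_mem s (ha.trans hs.1)).1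

theorem progress_nonneg (h : IsMotion P u q γ w k) {a b : ℝ} (ha : 0 ≤ a) (hab : a ≤ b) :
    0 ≤ ∫ s in a..b, k s :=
  intervalIntegral.integral_nonneg hab fun s hs => (h.rate_mem s (ha.trans hs.1)).1

theorem progress_le (h : IsMotion P u q γ w k) {a b : ℝ} (ha : 0 ≤ a) (hab : a ≤ b) :
    ∫ s in a..b, k s ≤ b - a := by
  have := intervalIntegral.integral_mono_on hab
    (h.intervalIntegrable_progress ha (ha.trans hab)) (intervalIntegrable_const (c := (1 : ℝ)))
    fun s hs => (h.rate_mem s (ha.trans hs.1)).2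
  simpa using this

/-- Without progress, a robot stays in its state. -/
theorem eq_of_progress_eq_zero (h : IsMotion P u q γ w k) {a b c : ℝ} (ha : 0 ≤ a) (hab : a ≤ b)
    (hw : ∀ s ∈ Icc a b, w s = c) (h0 : ∫ s in a..b, k s = 0) : γ b = γ a := by
  have hb := ha.trans hab
  refine Prod.ext ?_ ?_
  · have := h.norm_position_sub_le ha hab hw
    rw [h0, mul_zero] at this
    exact sub_eq_zero.1 (norm_le_zero_iff.1 this)
  · have : ∫ s in a..b, k s * (command P u (w s)).2 = 0 := by
      rw [← mul_zero (command P u c).2, ← h0, ← intervalIntegral.integral_const_mul]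
      refine intervalIntegral.integral_congr fun s hs => ?_
      rw [uIcc_of_le hab] at hs
      simp only [hw s hs, mul_comm]
    rw [h.orientation_sub ha hb, this, Real.Angle.coe_zero, add_zero]

end IsMotion

/-! ### Rigidity and existence of deadlocks -/

theorem IsTrajectory.continuousOn {P : RobotModel} {u : Fin 4 → ℝ} {n : ℕ}
    {x₀ : Fin n → RobotState} {γ : ℝ → Fin n → RobotState} (h : IsTrajectory P u x₀ γ) {b : ℝ}
    (hb : 0 ≤ b) : ContinuousOn γ (Icc 0 b) := by
  obtain ⟨w, k, hwk⟩ := h.motion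
  refine continuousOn_pi.2 fun i => ?_
  obtain ⟨h1, h2, h3, h4, h5⟩ := hwk i
  exact IsMotion.continuousOn ⟨h1, h2, fun t ht => (h3 t ht).1, fun t ht => (h3 t ht).2.2.2.1,
    h4, h5⟩ hb

/-- If two discs that touch are displaced towards each other, each by at least `m` times its
progress, their progresses being small, then neither has progressed. -/
theorem progress_eq_zero {e d₁ d₂ : Plane} {R m V G₁ G₂ : ℝ} (hm : 0 < m) (hR : 0 < R)
    (hG₁ : 0 ≤ G₁) (hG₂ : 0 ≤ G₂) (he : ‖e‖ = R) (hd : R ≤ ‖e + d₂ - d₁‖)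
    (h₁ : m * G₁ ≤ inner ℝ e d₁) (h₂ : m * G₂ ≤ inner ℝ (-e) d₂)
    (hn₁ : ‖d₁‖ ≤ V * G₁) (hn₂ : ‖d₂‖ ≤ V * G₂) (hV : V ^ 2 * (G₁ + G₂) ≤ m) :
    G₁ + G₂ = 0 := by
  -- Expand `‖e + (d₂ - d₁)‖ ^ 2 ≥ R ^ 2`. The linear term is at most `-2 * m * (G₁ + G₂)`, while
  -- the quadratic one is at most `m * (G₁ + G₂)` by `hV`; hence `m * (G₁ + G₂) ≤ 0`.
  have h3 : ‖d₂ - d₁‖ ≤ V * (G₁ + G₂) := by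
    have := norm_sub_le d₂ d₁
    linarith
  have h4 : ‖d₂ - d₁‖ ^ 2 ≤ (V * (G₁ + G₂)) ^ 2 := pow_le_pow_left₀ (norm_nonneg _) h3 2
  have h5 := norm_add_sq_real e (d₂ - d₁)
  rw [inner_sub_right, ← add_sub_assoc, he] at h5
  have h6 : R ^ 2 ≤ ‖e + d₂ - d₁‖ ^ 2 := pow_le_pow_left₀ hR.le hd 2
  rw [inner_neg_left] at h₂
  have h7 : (V * (G₁ + G₂)) ^ 2 ≤ m * (G₁ + G₂) := by
    have := mul_le_mul_of_nonneg_right hV (add_nonneg hG₁ hG₂)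
    nlinarith
  have h8 : m * (G₁ + G₂) ≤ 0 := by nlinarith
  nlinarith

/-- In a state in which the sensors are locally constant and all robots come in touching pairs,
both members of each pair being commanded towards each other, the only trajectory is the constant
one. -/
theorem IsTrajectory.eq_of_deadlock {P : RobotModel} {u : Fin 4 → ℝ} {n : ℕ}
    {x₀ : Fin n → RobotState} {γ : ℝ → Fin n → RobotState} (h : IsTrajectory P u x₀ γ)
    (mate : Fin n → Fin n) (hmate : ∀ i, mate i ≠ i) (hmm : ∀ i, mate (mate i) = i)
    (hd : ∀ i, dist (x₀ i).1 (x₀ (mate i)).1 = 2 * P.radius) {c : ℝ}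
    (hc : (c = 1 ∧ ∀ i, ∀ᶠ y in 𝓝 x₀, Sees P y i) ∨ (c = 0 ∧ ∀ i, ∀ᶠ y in 𝓝 x₀, ¬ Sees P y i))
    (hpush : ∀ i, 0 < (command P u c).1 *
      inner ℝ (heading (x₀ i).2) ((x₀ (mate i)).1 - (x₀ i).1))
    {t : ℝ} (ht : 0 ≤ t) : γ t = x₀ := by
  obtain ⟨w, k, hwk⟩ := h.motion
  have hmot : ∀ i, IsMotion P u (x₀ i) (fun t => γ t i) (fun t => w t i) (fun t => k t i) := by
    intro i
    obtain ⟨h1, h2, h3, h4, h5⟩ := hwk i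
    exact ⟨h1, h2, fun t ht => (h3 t ht).1, fun t ht => (h3 t ht).2.2.2.1, h4, h5⟩
  have hcont := h.continuousOn ht
  set V : ℝ := |(command P u c).1|
  obtain ⟨m, hm, hm0⟩ : ∃ m : ℝ, (∀ i, m < (command P u c).1 *
      inner ℝ (heading (x₀ i).2) ((x₀ (mate i)).1 - (x₀ i).1)) ∧ 0 < m := by
    have h1 : ∀ᶠ m : ℝ in 𝓝[>] 0, ∀ i, m < (command P u c).1 *
        inner ℝ (heading (x₀ i).2) ((x₀ (mate i)).1 - (x₀ i).1) :=
      eventually_all.2 fun i => nhdsWithin_le_nhds (gt_mem_nhds (hpush i))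
    exact (h1.and self_mem_nhdsWithin).exists
  -- The sensor condition on a trajectory concerns neighbourhoods of the current state, so the
  -- locally constant reading at `x₀` has to be passed on to all states near `x₀`.
  have hw : ∀ᶠ y in 𝓝 x₀, ∀ t, 0 ≤ t → γ t = y → ∀ i, w t i = c := by
    rcases hc with ⟨rfl, hs⟩ | ⟨rfl, hs⟩
    · filter_upwards [eventually_all.2 fun i => (hs i).eventually_nhds] with y hy t ht hty i
      exact ((hwk i).2.2.1 t ht).2.1 (hty ▸ nhdsWithin_le_nhds (hy i))
    · filter_upwards [eventually_all.2 fun i => (hs i).eventually_nhds] with y hy t ht hty i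
      exact ((hwk i).2.2.1 t ht).2.2.1 (hty ▸ nhdsWithin_le_nhds (hy i))
  have hp : ∀ᶠ y in 𝓝 x₀, ∀ i, m < (command P u c).1 *
      inner ℝ (heading (y i).2) ((x₀ (mate i)).1 - (x₀ i).1) := by
    refine eventually_all.2 fun i => ?_
    have hh := continuous_heading
    have hf : Continuous fun y : Fin n → RobotState => (command P u c).1 *
        inner ℝ (heading (y i).2) ((x₀ (mate i)).1 - (x₀ i).1) := by fun_prop
    exact hf.continuousAt.eventually (lt_mem_nhds (hm i))
  have hclosed : IsClosed ({s | γ s = x₀} ∩ Icc 0 t) := by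
    have := hcont.preimage_isClosed_of_isClosed isClosed_Icc (isClosed_singleton (x := x₀))
    rwa [inter_comm] at this
  -- Continuous induction: the times spent at `x₀` form a closed set, and from each such time before
  -- `t` a slightly later one is reached.
  refine hclosed.Icc_subset_of_forall_exists_gt h.start ?_ (right_mem_Icc.2 ht)
  rintro T ⟨hT, hT0, hTt⟩ T₁ (hT₁ : T < T₁)
  have hT : γ T = x₀ := hT
  have hnear : ∀ᶠ s in 𝓝[Icc 0 t] T, (∀ i, w s i = c) ∧ ∀ i, m < (command P u c).1 *
      inner ℝ (heading (γ s i).2) ((x₀ (mate i)).1 - (x₀ i).1) := by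
    have h1 : Tendsto γ (𝓝[Icc 0 t] T) (𝓝 x₀) := hT ▸ hcont T ⟨hT0, hTt.le⟩
    filter_upwards [h1.eventually (hw.and hp), self_mem_nhdsWithin] with s hs hs0
    exact ⟨hs.1 s hs0.1 rfl, hs.2⟩
  have hnear := nhdsWithin_mono T (Icc_subset_Icc_left hT0) hnear
  rw [nhdsWithin_Icc_eq_nhdsGE hTt, mem_nhdsGE_iff_exists_Icc_subset] at hnear
  obtain ⟨U, hU, hnear⟩ := hnear
  -- Each progress on `[T, S]` is at most `S - T`, so this bound gives the smallness `V ^ 2 * (G₁ +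
  -- G₂) ≤ m` needed in `progress_eq_zero`; the `+ 1` keeps the denominator positive.
  obtain ⟨S, hTS, hS⟩ : ∃ S, T < S ∧ S ≤ min T₁ (min U (T + m / (2 * V ^ 2 + 1))) :=
    ⟨_, lt_min hT₁ (lt_min hU (lt_add_of_pos_right T (by positivity))), le_rfl⟩
  obtain ⟨hS₁, hSU, hSm⟩ : S ≤ T₁ ∧ S ≤ U ∧ S ≤ T + m / (2 * V ^ 2 + 1) := by
    simpa only [le_min_iff] using hS
  have hwS : ∀ i, ∀ s ∈ Icc T S, w s i = c := fun i s hs => (hnear ⟨hs.1, hs.2.trans hSU⟩).1 i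
  have hpS : ∀ i, ∀ s ∈ Icc T S, m ≤ (command P u c).1 *
      inner ℝ (heading (γ s i).2) ((x₀ (mate i)).1 - (x₀ i).1) :=
    fun i s hs => ((hnear ⟨hs.1, hs.2.trans hSU⟩).2 i).le
  refine ⟨S, ?_, hTS, hS₁⟩
  have hG : ∀ i, ∫ s in T..S, k s i = 0 := by
    intro i
    have hnn : ∀ i, 0 ≤ ∫ s in T..S, k s i := fun i => (hmot i).progress_nonneg hT0 hTS.le
    have hmate' := (hmot (mate i)).le_inner_position_sub hT0 hTS.le (hwS _) (hpS _)
    rw [hmm, ← neg_sub] at hmate'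
    have hVb : V ^ 2 * ((∫ s in T..S, k s i) + ∫ s in T..S, k s (mate i)) ≤ m := by
      have h1 := (hmot i).progress_le hT0 hTS.le
      have h2 := (hmot (mate i)).progress_le hT0 hTS.le
      have h3 : (S - T) * (2 * V ^ 2 + 1) ≤ m := by
        rw [← le_div_iff₀ (by positivity)]; linarith
      nlinarith [sq_nonneg V]
    have hsum := progress_eq_zero (e := (x₀ (mate i)).1 - (x₀ i).1) (R := 2 * P.radius) hm0
      (by linarith [P.radius_pos]) (hnn i) (hnn (mate i))
      (by rw [← dist_eq_norm, dist_comm, hd]) ?_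
      ((hmot i).le_inner_position_sub hT0 hTS.le (hwS i) (hpS i)) hmate'
      ((hmot i).norm_position_sub_le hT0 hTS.le (hwS i))
      ((hmot (mate i)).norm_position_sub_le hT0 hTS.le (hwS (mate i))) hVb
    · linarith [hnn i, hnn (mate i)]
    · have hfree := h.free S (hT0.trans hTS.le) (mate i) i (hmate i)
      rw [dist_eq_norm] at hfree
      refine hfree.trans_eq (congrArg norm ?_)
      rw [hT]
      abel
  have : γ S = γ T := funext fun i =>
    (hmot i).eq_of_progress_eq_zero hT0 hTS.le (hwS i) (hG i)
  exact this.trans hT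

/-- In a deadlock, remaining in place is a trajectory. -/
theorem isTrajectory_const_of_deadlock {P : RobotModel} {u : Fin 4 → ℝ} {n : ℕ}
    {x₀ : Fin n → RobotState} (hfree : x₀ ∈ freeSpace P n)
    (mate : Fin n → Fin n) (hmate : ∀ i, mate i ≠ i)
    (hd : ∀ i, dist (x₀ i).1 (x₀ (mate i)).1 = 2 * P.radius) {c : ℝ}
    (hc : (c = 1 ∧ ∀ i, Sees P x₀ i) ∨ (c = 0 ∧ ∀ i, ¬ Sees P x₀ i))
    (hpush : ∀ i, 0 < (command P u c).1 *
      inner ℝ (heading (x₀ i).2) ((x₀ (mate i)).1 - (x₀ i).1)) :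
    IsTrajectory P u x₀ fun _ => x₀ where
  start := rfl
  free _ _ := hfree
  motion := by
    -- Rate of progress 0 is admissible because every robot is blocked by its mate.
    refine ⟨fun _ _ => c, fun _ _ => 0, fun i => ⟨measurable_const, measurable_const,
      fun t _ => ⟨?_, fun h => ?_, fun h => ?_, by simp, fun _ => ?_⟩, by simp, by simp⟩⟩
    · rcases hc with ⟨rfl, -⟩ | ⟨rfl, -⟩ <;> simp
    · rcases hc with ⟨rfl, -⟩ | ⟨-, hc⟩
      exacts [rfl, absurd (h.self_of_nhdsWithin hfree) (hc i)]
    · rcases hc with ⟨-, hc⟩ | ⟨rfl, -⟩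
      exacts [absurd (hc i) (h.self_of_nhdsWithin hfree), rfl]
    · exact blocked_of_inner_pos P x₀ _ (hmate i) (hd i) (hpush i)

/-! ### The deadlocked rectangle -/

theorem exists_heading_eq {a b : ℝ} (h : a ^ 2 + b ^ 2 = 1) :
    ∃ θ : Real.Angle, heading θ = !₂[a, b] := by
  have hn : ‖(⟨a, b⟩ : ℂ)‖ = 1 := by
    rw [← sq_eq_sq₀ (norm_nonneg _) zero_le_one, ← Complex.normSq_eq_norm_sq, Complex.normSq_mk]
    linarith
  have h0 : (⟨a, b⟩ : ℂ) ≠ 0 := by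
    rw [← norm_ne_zero_iff, hn]; exact one_ne_zero
  refine ⟨(Complex.arg ⟨a, b⟩ : ℝ), ?_⟩
  simp [heading, Complex.cos_arg h0, Complex.sin_arg, hn]

/-- Signs of the first coordinates of the corners of a rectangle. -/
def cornerX : Fin 4 → ℝ := ![1, 1, -1, -1]

/-- Signs of the second coordinates of the corners of a rectangle. -/
def cornerY : Fin 4 → ℝ := ![1, -1, 1, -1]

/-- The corner with the same first coordinate. -/
def cornerMate : Fin 4 → Fin 4 := ![1, 0, 3, 2]

/-- The corner with the same second coordinate. -/
def cornerOpposite : Fin 4 → Fin 4 := ![2, 3, 0, 1]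

theorem cornerX_sq (i : Fin 4) : cornerX i ^ 2 = 1 := by
  fin_cases i <;> simp [cornerX]

theorem cornerY_sq (i : Fin 4) : cornerY i ^ 2 = 1 := by
  fin_cases i <;> simp [cornerY]

theorem abs_cornerX (i : Fin 4) : |cornerX i| = 1 := by
  fin_cases i <;> simp [cornerX]

/-- Robots at the corners of a rectangle of sides `2L` and `2r`, robot `i` looking in direction
`(-τ C X, -σ S Y)`, where `(X, Y)` are the signs of its corner. -/
theorem exists_rectangle (P : RobotModel) (L : ℝ) {C S τ σ : ℝ} (h : C ^ 2 + S ^ 2 = 1)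
    (hτ : τ ^ 2 = 1) (hσ : σ ^ 2 = 1) :
    ∃ x : Fin 4 → RobotState, ∀ i,
      (x i).1 = !₂[cornerX i * L, cornerY i * P.radius] ∧
      heading (x i).2 = !₂[-(τ * C * cornerX i), -(σ * S * cornerY i)] := by
  have hθ : ∀ i, ∃ θ : Real.Angle,
      heading θ = !₂[-(τ * C * cornerX i), -(σ * S * cornerY i)] := fun i => by
    refine exists_heading_eq ?_
    rw [neg_sq, neg_sq, mul_pow, mul_pow, mul_pow, mul_pow, hτ, hσ, cornerX_sq, cornerY_sq]
    linarith
  choose θ hθ using hθ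
  exact ⟨fun i => (!₂[cornerX i * L, cornerY i * P.radius], θ i), fun i => ⟨rfl, hθ i⟩⟩

/-- If the robots have nonzero commanded speed in mode `c`, then they have a deadlocked
configuration in that mode which is not aggregated. -/
theorem exists_deadlock (P : RobotModel) (u : Fin 4 → ℝ) {c : ℝ} (hc : c = 0 ∨ c = 1)
    (hv : (command P u c).1 ≠ 0) :
    ∃ x₀ ∈ freeSpace P 4, x₀ ∉ aggregated P 4 ∧ IsTrajectory P u x₀ (fun _ => x₀) ∧
      ∀ γ, IsTrajectory P u x₀ γ → ∀ t, 0 ≤ t → γ t = x₀ := by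
  have hr := P.radius_pos
  have hρ := P.padding_nonneg
  -- Half the distance between the two pairs; it exceeds `r + ρ`, so the padded discs stay off the
  -- vertical axis.
  set L : ℝ := 2 * P.radius + P.padding
  -- The slope `S / C = r / (4L)` makes a ray drift vertically by only `r / 2` over the distance
  -- `2L` to the other pair, so it crosses the interior of the disc there; yet `S > 0` leaves a push
  -- towards the mate.
  obtain ⟨C, S, hCS, hC, hS, hslope⟩ : ∃ C S : ℝ, C ^ 2 + S ^ 2 = 1 ∧ 0 < C ∧ 0 < S ∧
      S * (4 * L) = C * P.radius := by
    have hq : 0 < P.radius / (4 * L) := by positivity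
    refine ⟨Real.cos (Real.arctan (P.radius / (4 * L))),
      Real.sin (Real.arctan (P.radius / (4 * L))), Real.cos_sq_add_sin_sq _,
      Real.cos_arctan_pos _, ?_, ?_⟩
    · rw [Real.sin_arctan]; positivity
    · have h1 := Real.tan_mul_cos (Real.cos_arctan_pos (P.radius / (4 * L))).ne'
      rw [Real.tan_arctan] at h1
      have hL0 : L ≠ 0 := by positivity
      rw [← h1]
      field_simp
  have hSC : S < C := by nlinarith
  -- `τ` selects facing the other pair or facing outwards. `σ` is the sign of the speed: with
  -- negative speed the heading is tilted away from the mate and the robot backs into it.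
  obtain ⟨τ, hτ, hτ0, hτ1⟩ : ∃ τ : ℝ, τ ^ 2 = 1 ∧ (c = 0 → τ = -1) ∧ (c = 1 → τ = 1) := by
    rcases hc with rfl | rfl
    · exact ⟨-1, by norm_num, by simp, by simp⟩
    · exact ⟨1, by norm_num, by simp, by simp⟩
  obtain ⟨σ, hσ, hσv⟩ : ∃ σ : ℝ, σ ^ 2 = 1 ∧ 0 < (command P u c).1 * σ := by
    rcases hv.lt_or_gt with h | h
    · exact ⟨-1, by norm_num, by linarith⟩
    · exact ⟨1, by norm_num, by linarith⟩
  obtain ⟨x, hx⟩ := exists_rectangle P L hCS hτ hσ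
  have hmate : ∀ i, cornerMate i ≠ i := by decide
  have hmm : ∀ i, cornerMate (cornerMate i) = i := by decide
  have hopp : ∀ i, cornerOpposite i ≠ i := by decide
  have hmX : ∀ i, cornerX (cornerMate i) = cornerX i := by
    intro i; fin_cases i <;> simp [cornerX, cornerMate]
  have hmY : ∀ i, cornerY (cornerMate i) = -cornerY i := by
    intro i; fin_cases i <;> simp [cornerY, cornerMate]
  have hoX : ∀ i, cornerX (cornerOpposite i) = -cornerX i := by
    intro i; fin_cases i <;> simp [cornerX, cornerOpposite]
  have hoY : ∀ i, cornerY (cornerOpposite i) = cornerY i := by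
    intro i; fin_cases i <;> simp [cornerY, cornerOpposite]
  -- The two fractions are the indicators that corners `i` and `j` differ in the first and in the
  -- second sign; distinct corners differ in at least one.
  have hproj : ∀ i j, j ≠ i →
      1 ≤ (1 - cornerX j * cornerX i) / 2 + (1 - cornerY j * cornerY i) / 2 ∧
      0 ≤ (1 - cornerX j * cornerX i) / 2 ∧ 0 ≤ (1 - cornerY j * cornerY i) / 2 := by
    intro i j hij
    fin_cases i <;> fin_cases j <;> first | exact absurd rfl hij | norm_num [cornerX, cornerY]
  have hfree : x ∈ freeSpace P 4 := by
    intro i j hij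
    obtain ⟨h1, h2, h3⟩ := hproj j i hij
    refine (pow_le_pow_iff_left₀ (by positivity) dist_nonneg two_ne_zero).1 ?_
    rw [plane_dist_sq, (hx i).1, (hx j).1]
    have hXi := cornerX_sq i
    have hXj := cornerX_sq j
    have hYi := cornerY_sq i
    have hYj := cornerY_sq j
    simp only [Matrix.cons_val_zero, Matrix.cons_val_one]
    have e1 : (cornerX i * L - cornerX j * L) ^ 2 =
        4 * L ^ 2 * ((1 - cornerX i * cornerX j) / 2) := by linear_combination L ^ 2 * (hXi + hXj)
    have e2 : (cornerY i * P.radius - cornerY j * P.radius) ^ 2 =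
        4 * P.radius ^ 2 * ((1 - cornerY i * cornerY j) / 2) := by
      linear_combination P.radius ^ 2 * (hYi + hYj)
    rw [e1, e2]
    have h4 : P.radius ^ 2 ≤ L ^ 2 := pow_le_pow_left₀ hr.le (by linarith) 2
    nlinarith [mul_le_mul_of_nonneg_right h4 h2, sq_nonneg P.radius]
  have hd : ∀ i, dist (x i).1 (x (cornerMate i)).1 = 2 * P.radius := by
    intro i
    rw [← sq_eq_sq₀ dist_nonneg (by linarith), plane_dist_sq, (hx i).1, (hx (cornerMate i)).1]
    simp only [Matrix.cons_val_zero, Matrix.cons_val_one, hmX, hmY]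
    linear_combination 4 * P.radius ^ 2 * cornerY_sq i
  have hpush : ∀ i, 0 < (command P u c).1 *
      inner ℝ (heading (x i).2) ((x (cornerMate i)).1 - (x i).1) := by
    intro i
    have : inner ℝ (heading (x i).2) ((x (cornerMate i)).1 - (x i).1) = σ * (2 * S * P.radius) := by
      rw [plane_inner, (hx i).1, (hx (cornerMate i)).1, (hx i).2]
      simp only [PiLp.sub_apply, Matrix.cons_val_zero, Matrix.cons_val_one, hmX,
        hmY]
      linear_combination 2 * σ * S * P.radius * cornerY_sq i
    rw [this, ← mul_assoc]
    positivity
  have hsense : (c = 1 ∧ ∀ i, ∀ᶠ y in 𝓝 x, Sees P y i) ∨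
      (c = 0 ∧ ∀ i, ∀ᶠ y in 𝓝 x, ¬ Sees P y i) := by
    rcases hc with rfl | rfl
    · refine Or.inr ⟨rfl, fun i => ?_⟩
      have hX := cornerX_sq i
      have hY := cornerY_sq i
      -- The outward diagonal separates: the heading has component `C - σ * S > 0` along it, and
      -- every other centre lies behind by at least `2r`, whereas the diagonal has norm below 2.
      refine eventually_not_sees P x !₂[cornerX i, cornerY i] ?_ fun j hij => ?_
      · rw [plane_inner, (hx i).2, hτ0 rfl]
        simp only [Matrix.cons_val_zero, Matrix.cons_val_one]
        have : -(-1 * C * cornerX i) * cornerX i + -(σ * S * cornerY i) * cornerY i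
            = C - σ * S := by linear_combination C * hX - σ * S * hY
        rw [this]
        nlinarith
      · have hn : ‖(!₂[cornerX i, cornerY i] : Plane)‖ < 2 := by
          refine lt_of_pow_lt_pow_left₀ 2 zero_le_two ?_
          rw [← real_inner_self_eq_norm_sq, plane_inner]
          simp only [Matrix.cons_val_zero, Matrix.cons_val_one]
          linarith
        obtain ⟨h1, h2, h3⟩ := hproj i j hij
        have : inner ℝ ((x i).1 - (x j).1) !₂[cornerX i, cornerY i] =
            2 * L * ((1 - cornerX j * cornerX i) / 2)
              + 2 * P.radius * ((1 - cornerY j * cornerY i) / 2) := by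
          rw [plane_inner, (hx i).1, (hx j).1]
          simp only [PiLp.sub_apply, Matrix.cons_val_zero, Matrix.cons_val_one]
          linear_combination L * hX + P.radius * hY
        rw [this]
        have h4 : P.radius ≤ L := by linarith
        nlinarith [mul_le_mul_of_nonneg_right h4 h2]
    · refine Or.inl ⟨rfl, fun i => ?_⟩
      -- At ray parameter `2L / C` the ray is exactly above or below the opposite centre, at
      -- distance `r / 2`.
      refine eventually_sees P x (hopp i) (s := 2 * L / C) (by positivity) ?_
      refine lt_of_pow_lt_pow_left₀ 2 hr.le ?_
      rw [plane_dist_sq, (hx i).1, (hx (cornerOpposite i)).1, (hx i).2, hτ1 rfl]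
      simp only [PiLp.add_apply, PiLp.smul_apply, Matrix.cons_val_zero,
        Matrix.cons_val_one, hoX, hoY, smul_eq_mul]
      have e1 : cornerX i * L + 2 * L / C * -(1 * C * cornerX i) - -cornerX i * L = 0 := by
        field_simp; ring
      have e2 : cornerY i * P.radius + 2 * L / C * -(σ * S * cornerY i) - cornerY i * P.radius
          = -(σ * cornerY i) * (P.radius / 2) := by
        field_simp
        linear_combination (-σ * cornerY i) * hslope
      have e3 := cornerY_sq i
      rw [e1, e2, mul_pow, neg_sq, mul_pow, hσ, e3]
      nlinarith
  refine ⟨x, hfree, ?_, ?_, fun γ hγ t ht =>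
    hγ.eq_of_deadlock cornerMate hmate hmm hd hsense hpush ht⟩
  · refine not_mem_aggregated_of_gap P x 0 0 (fun i => ?_) (i := 2) (j := 0) ?_ ?_
    · rw [(hx i).1]
      simp only [Matrix.cons_val_zero, sub_zero]
      rw [abs_mul, abs_cornerX, one_mul, abs_of_pos (by positivity)]
      linarith
    · rw [(hx 2).1]
      simp [cornerX]
      positivity
    · rw [(hx 0).1]
      simp [cornerX]
      positivity
  · refine isTrajectory_const_of_deadlock hfree cornerMate hmate hd (hsense.imp ?_ ?_) hpush
    · exact fun h => ⟨h.1, fun i => (h.2 i).self_of_nhds⟩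
    · exact fun h => ⟨h.1, fun i => (h.2 i).self_of_nhds⟩

/-! ### Motion on a line with two speeds -/

theorem intervalIntegrable_ite {p : ℝ → Prop} (hs : MeasurableSet {t | p t}) [DecidablePred p]
    (a b x y : ℝ) :
    IntervalIntegrable (fun t => if p t then a else b) MeasureTheory.volume x y := by
  refine (intervalIntegrable_const (c := max |a| |b|)).mono_fun
    (Measurable.ite hs measurable_const measurable_const).aestronglyMeasurable
    (.of_forall fun t => ?_)
  refine le_trans ?_ (le_abs_self _)
  beta_reduce
  split_ifs
  exacts [le_max_left _ _, le_max_right _ _]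

/-- A point moving on a line at speed `b` in a set `W` and at speed `a` outside of it. -/
theorem exists_two_speed_motion {W : Set ℝ} (hW : MeasurableSet W) (hfr : (frontier W).Countable)
    {a b : ℝ} (ha : 0 < a) (hb : 0 < b) [DecidablePred (· ∈ W)] :
    ∃ Θ : ℝ → ℝ, Continuous Θ ∧ ∀ t, Θ t = ∫ s in (0 : ℝ)..t, if Θ s ∈ W then b else a := by
  -- `g` is the reciprocal speed, and its primitive `T` is the time needed to reach a position. The
  -- motion sought is the inverse of `T`.
  set g : ℝ → ℝ := fun x => if x ∈ W then b⁻¹ else a⁻¹ with hg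
  have hgm : Measurable g := Measurable.ite hW measurable_const measurable_const
  set m : ℝ := min b⁻¹ a⁻¹
  have hm0 : 0 < m := lt_min (inv_pos.2 hb) (inv_pos.2 ha)
  have hmg : ∀ x, m ≤ g x := fun x => by
    simp only [hg]; split_ifs
    exacts [min_le_left _ _, min_le_right _ _]
  have hgi : ∀ x y, IntervalIntegrable g MeasureTheory.volume x y :=
    intervalIntegrable_ite (p := (· ∈ W)) hW _ _
  set T : ℝ → ℝ := fun x => ∫ s in (0 : ℝ)..x, g s with hT
  have hTc : Continuous T := intervalIntegral.continuous_primitive hgi 0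
  have hTd : ∀ x y, x ≤ y → m * (y - x) ≤ T y - T x := fun x y hxy => by
    have h1 := intervalIntegral.integral_mono_on hxy (intervalIntegrable_const (c := m))
      (hgi x y) fun s _ => hmg s
    rw [intervalIntegral.integral_const, smul_eq_mul, mul_comm] at h1
    rwa [hT, intervalIntegral.integral_interval_sub_left (hgi 0 y) (hgi 0 x)]
  have hT0 : T 0 = 0 := intervalIntegral.integral_same
  have hTm : StrictMono T := fun x y hxy => by
    have := hTd x y hxy.le
    have := mul_pos hm0 (sub_pos.2 hxy)
    linarith
  have hTs : Function.Surjective T := by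
    refine hTc.surjective ?_ ?_
    · refine tendsto_atTop_mono' _ ?_ (tendsto_id.const_mul_atTop hm0)
      filter_upwards [eventually_ge_atTop 0] with x hx
      have := hTd 0 x hx
      rwa [hT0, sub_zero, sub_zero] at this
    · refine tendsto_atBot_mono' _ ?_ (tendsto_id.const_mul_atBot hm0)
      filter_upwards [eventually_le_atBot 0] with x hx
      have := hTd x 0 hx
      simp only [id]
      linarith
  set e := hTm.orderIsoOfSurjective T hTs
  have heT : ∀ t, T (e.symm t) = t := e.apply_symm_apply
  have hec : Continuous e.symm := e.symm.continuous
  refine ⟨e.symm, hec, fun t => ?_⟩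
  have hderiv : ∀ t, e.symm t ∉ frontier W →
      HasDerivAt e.symm (if e.symm t ∈ W then b else a) t := by
    intro t ht
    have hgc : ContinuousAt g (e.symm t) := by
      by_cases hmem : e.symm t ∈ W
      · have hint : W ∈ 𝓝 (e.symm t) := by
          rw [mem_interior_iff_mem_nhds.symm]
          by_contra h
          exact ht ⟨subset_closure hmem, h⟩
        refine (continuousAt_const (y := b⁻¹)).congr ?_
        filter_upwards [hint] with x hx
        simp only [hg, if_pos hx]
      · have hint : Wᶜ ∈ 𝓝 (e.symm t) := by
          rw [← mem_interior_iff_mem_nhds, interior_compl]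
          intro h
          exact ht ⟨h, fun h => hmem (interior_subset h)⟩
        refine (continuousAt_const (y := a⁻¹)).congr ?_
        filter_upwards [hint] with x hx
        simp only [hg, if_neg hx]
    have h1 := intervalIntegral.integral_hasDerivAt_right (hgi 0 (e.symm t))
      hgm.stronglyMeasurable.stronglyMeasurableAtFilter hgc
    have h2 := HasDerivAt.of_local_left_inverse (f := T) (g := e.symm) hec.continuousAt h1
      (hm0.trans_le (hmg _)).ne' (.of_forall heT)
    have h3 : (if e.symm t ∈ W then b else a) = (g (e.symm t))⁻¹ := by
      simp only [hg]; split_ifs <;> simp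
    rw [h3]
    exact h2
  -- The inverse is injective, so it meets the frontier, where differentiability may fail, at only
  -- countably many times; the fundamental theorem of calculus tolerates these.
  have hcount : (e.symm ⁻¹' frontier W).Countable := hfr.preimage e.symm.injective
  have h0 : e.symm 0 = 0 := (congrArg e.symm hT0).symm.trans (e.symm_apply_apply 0)
  have hint : IntervalIntegrable (fun s => if e.symm s ∈ W then b else a)
      MeasureTheory.volume 0 t :=
    intervalIntegrable_ite (p := (e.symm · ∈ W)) (hec.measurable hW) b a 0 t
  rw [MeasureTheory.integral_eq_of_hasDerivAt_off_countable e.symm _ hcount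
    hec.continuousOn (fun x hx => hderiv x hx.2) hint, h0, sub_zero]

/-- Makes the frontier of the set of seeing angles countable, as `exists_two_speed_motion` requires.
-/
theorem countable_cos_eq (c : ℝ) : {x : ℝ | c = Real.cos x}.Countable := by
  rcases ({x : ℝ | c = Real.cos x}).eq_empty_or_nonempty with h | ⟨α, rfl⟩
  · rw [h]; exact countable_empty
  · refine ((countable_range fun k : ℤ => 2 * (k : ℝ) * Real.pi + α).union
      (countable_range fun k : ℤ => 2 * (k : ℝ) * Real.pi - α)).mono fun x hx => ?_
    obtain ⟨k, hk | hk⟩ := Real.cos_eq_cos_iff.1 hx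
    exacts [Or.inl ⟨k, hk.symm⟩, Or.inr ⟨k, hk.symm⟩]

/-! ### Pairs of robots that only rotate -/

/-- Two robots at distance `2L`, both turned by `θ` away from facing each other. -/
noncomputable def pairState (L θ : ℝ) : Fin 2 → RobotState :=
  ![(!₂[-L, 0], (θ : Real.Angle)), (!₂[L, 0], ((θ + Real.pi : ℝ) : Real.Angle))]

theorem continuous_pairState (L : ℝ) : Continuous (pairState L) := by
  have h := Real.Angle.continuous_coe
  refine continuous_pi fun i => ?_
  fin_cases i
  · exact continuous_const.prodMk h
  · exact continuous_const.prodMk (h.comp (continuous_id.add continuous_const))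

theorem dist_pairState {L : ℝ} (hL : 0 ≤ L) (θ : ℝ) {i j : Fin 2} (hij : i ≠ j) :
    dist (pairState L θ i).1 (pairState L θ j).1 = 2 * L := by
  rw [← sq_eq_sq₀ dist_nonneg (by linarith), plane_dist_sq]
  fin_cases i <;> fin_cases j <;> first
    | exact absurd rfl hij
    | simp [pairState]; ring

theorem pairState_mem_freeSpace {P : RobotModel} {L : ℝ} (hL : P.radius ≤ L) (θ : ℝ) :
    pairState L θ ∈ freeSpace P 2 := fun i j hij => by
  rw [dist_pairState (P.radius_pos.le.trans hL) θ hij]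
  linarith

/-- Cosine of the half angle at which a disc of radius `r` appears from distance `2L`. -/
noncomputable def sightCos (P : RobotModel) (L : ℝ) : ℝ := √(1 - (P.radius / (2 * L)) ^ 2)

/-- Law of cosines with the square completed: `s = 2 * L * cos θ` is the foot of the perpendicular
from the other centre. By point symmetry the formula is the same for both robots. -/
theorem dist_ray_pairState_sq (L θ s : ℝ) {i j : Fin 2} (hij : j ≠ i) :
    dist ((pairState L θ i).1 + s • heading (pairState L θ i).2) (pairState L θ j).1 ^ 2
      = (s - 2 * L * Real.cos θ) ^ 2 + (2 * L) ^ 2 * (1 - Real.cos θ ^ 2) := by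
  have h := Real.sin_sq_add_cos_sq θ
  rw [plane_dist_sq]
  fin_cases i <;> fin_cases j <;> first
    | exact absurd rfl hij
    | simp [pairState, heading]; linear_combination s ^ 2 * h

/-- For `cos θ ≥ 0` the foot of the perpendicular lies on the ray and decides; for `cos θ < 0` the
whole ray stays at distance at least `2L > r`. The criterion does not depend on `i`, so one weight
function serves both robots. -/
theorem sees_pairState_iff {P : RobotModel} {L : ℝ} (hL : P.radius ≤ L) (θ : ℝ) (i : Fin 2) :
    Sees P (pairState L θ) i ↔ sightCos P L ≤ Real.cos θ := by
  have hr := P.radius_pos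
  have hL0 : 0 < L := hr.trans_le hL
  have hq : P.radius / (2 * L) ≤ 1 := (div_le_one (by positivity)).2 (by linarith)
  have hq0 : 0 ≤ P.radius / (2 * L) := by positivity
  have hrad : P.radius ^ 2 = (2 * L) ^ 2 * (P.radius / (2 * L)) ^ 2 := by field_simp
  constructor
  · rintro ⟨j, hj, s, hs, hd⟩
    have h1 := pow_le_pow_left₀ dist_nonneg hd 2
    rw [dist_ray_pairState_sq L θ s hj] at h1
    have hcos : 0 ≤ Real.cos θ := by
      by_contra! h
      have h2 : 0 ≤ s * L * -Real.cos θ := by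
        have := h.le
        have : 0 ≤ -Real.cos θ := by linarith
        positivity
      nlinarith [sq_nonneg s]
    refine (Real.sqrt_le_left hcos).2 ?_
    have h3 : (2 * L) ^ 2 * (1 - Real.cos θ ^ 2) ≤ (2 * L) ^ 2 * (P.radius / (2 * L)) ^ 2 := by
      rw [← hrad]; nlinarith [sq_nonneg (s - 2 * L * Real.cos θ)]
    have h4 := le_of_mul_le_mul_left h3 (by positivity)
    linarith
  · intro h
    have hcos : 0 ≤ Real.cos θ := (Real.sqrt_nonneg _).trans h
    have h1 := (Real.sqrt_le_left hcos).1 h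
    obtain ⟨j, hj⟩ := exists_ne i
    refine ⟨j, hj, 2 * L * Real.cos θ, by positivity, ?_⟩
    refine (pow_le_pow_iff_left₀ dist_nonneg hr.le two_ne_zero).1 ?_
    rw [dist_ray_pairState_sq L θ _ hj, hrad]
    have := mul_le_mul_of_nonneg_left h1 (sq_nonneg (2 * L))
    nlinarith

/-- Robots that can only rotate: a rotation that obeys the sensors yields a trajectory. -/
theorem isTrajectory_pairState {P : RobotModel} {u : Fin 4 → ℝ} {L : ℝ} (hL : P.radius ≤ L)
    (hv : ∀ w, (command P u w).1 = 0) {Θ w : ℝ → ℝ} (hw : Measurable w)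
    (hw1 : ∀ t, w t ∈ Icc (0 : ℝ) 1)
    (hs : ∀ t i, (∀ᶠ y in 𝓝[freeSpace P 2] (pairState L (Θ t)), Sees P y i) → w t = 1)
    (hns : ∀ t i, (∀ᶠ y in 𝓝[freeSpace P 2] (pairState L (Θ t)), ¬ Sees P y i) → w t = 0)
    (hΘ : ∀ t, Θ t = Θ 0 + ∫ s in (0 : ℝ)..t, (command P u (w s)).2) :
    IsTrajectory P u (pairState L (Θ 0)) fun t => pairState L (Θ t) where
  start := rfl
  free t _ := pairState_mem_freeSpace hL _
  motion := by
    refine ⟨fun t _ => w t, fun _ _ => 1, fun i => ⟨hw, measurable_const, fun t _ =>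
      ⟨hw1 t, hs t i, hns t i, by simp, by simp⟩, fun t _ => ?_, fun t _ => ?_⟩⟩
    · simp only [hv, mul_zero, zero_smul, intervalIntegral.integral_zero, add_zero]
      fin_cases i <;> rfl
    · simp only [one_mul]
      fin_cases i
      · simp only [pairState, Fin.zero_eta, Matrix.cons_val_zero, ← Real.Angle.coe_add]
        rw [hΘ t]
      · change ((Θ t + Real.pi : ℝ) : Real.Angle) = ((Θ 0 + Real.pi : ℝ) : Real.Angle) + _
        rw [← Real.Angle.coe_add, hΘ t, add_right_comm]

/-- Supplies the Filippov weight at which two opposing turning rates cancel. -/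
theorem convex_combination_eq_zero {a b : ℝ} (h : a * b ≤ 0) :
    ∃ w ∈ Icc (0 : ℝ) 1, (1 - w) * a + w * b = 0 := by
  by_cases hab : a = b
  · subst hab
    have : a = 0 := by nlinarith
    exact ⟨0, by simp, by simp [this]⟩
  · have hab' : a - b ≠ 0 := sub_ne_zero.2 hab
    refine ⟨a / (a - b), ?_, by field_simp; ring⟩
    rcases hab'.lt_or_gt with h' | h'
    · have : a ≤ 0 := by nlinarith
      exact ⟨div_nonneg_of_nonpos this h'.le, (div_le_one_of_neg h').2 (by nlinarith)⟩
    · have : 0 ≤ a := by nlinarith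
      exact ⟨div_nonneg this h'.le, (div_le_one h').2 (by nlinarith)⟩

/-- Robots that can only rotate have a trajectory from some state of any separated pair. -/
theorem exists_isTrajectory_pairState {P : RobotModel} {u : Fin 4 → ℝ} {L : ℝ}
    (hL : P.radius ≤ L) (hv : ∀ w, (command P u w).1 = 0) :
    ∃ (θ : ℝ) (γ : ℝ → Fin 2 → RobotState), IsTrajectory P u (pairState L θ) γ := by
  have hfree := fun θ => pairState_mem_freeSpace hL θ
  rcases le_or_gt ((command P u 0).2 * (command P u 1).2) 0 with hω | hω
  -- Both robots rest at the largest angle of sight, where the sensor is discontinuous and any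
  -- weight is allowed.
  · obtain ⟨w, hw, hw0⟩ := convex_combination_eq_zero hω
    have hc1 : sightCos P L < 1 := by
      have h1 : 0 < P.radius / (2 * L) := by
        have := P.radius_pos
        have : 0 < L := this.trans_le hL
        positivity
      rw [sightCos, Real.sqrt_lt' one_pos]
      nlinarith
    have hc0 : 0 ≤ sightCos P L := Real.sqrt_nonneg _
    have hcos := Real.cos_arccos (by linarith) hc1.le
    refine ⟨_, _, isTrajectory_pairState (Θ := fun _ => Real.arccos (sightCos P L))
      (w := fun _ => w) hL hv measurable_const (fun _ => hw) (fun t i h => ?_)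
      (fun t i h => ?_) fun t => ?_⟩
    -- Slightly larger angles lose sight, so the reading is not locally 1; at the angle itself the
    -- ray still touches the closed disc, so it is not locally 0 either.
    · exfalso
      have h1 : Tendsto (pairState L) (𝓝[>] (Real.arccos (sightCos P L)))
          (𝓝[freeSpace P 2] (pairState L (Real.arccos (sightCos P L)))) :=
        tendsto_nhdsWithin_iff.2 ⟨(continuous_pairState L).continuousAt.mono_left
          nhdsWithin_le_nhds, .of_forall hfree⟩
      have h2 : Real.arccos (sightCos P L) < Real.pi :=
        (Real.arccos_le_pi_div_two.2 hc0).trans_lt (by linarith [Real.pi_pos])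
      obtain ⟨θ, hθ, hθ1⟩ := ((h1.eventually h).and (Ioo_mem_nhdsGT h2)).exists
      rw [sees_pairState_iff hL] at hθ
      have := Real.cos_lt_cos_of_nonneg_of_le_pi (Real.arccos_nonneg _) hθ1.2.le hθ1.1
      rw [hcos] at this
      linarith
    · exact absurd ((sees_pairState_iff hL _ i).2 hcos.ge) (h.self_of_nhdsWithin (hfree _))
    · have h1 : (command P u w).2 = 0 := by
        rw [← hw0]; simp [command_snd]
      simp [h1]
  · set W : Set ℝ := {x | sightCos P L ≤ Real.cos x}
    have hWc : IsClosed W := isClosed_le continuous_const Real.continuous_cos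
    have hfr : (frontier W).Countable := (countable_cos_eq (sightCos P L)).mono
      (frontier_le_subset_eq continuous_const Real.continuous_cos)
    -- The sign `σ` reduces to positive turning rates; since cosine is even, reversing the angle
    -- does not change the sensor reading.
    obtain ⟨σ, hσ, ha, hb⟩ : ∃ σ : ℝ, (σ = 1 ∨ σ = -1) ∧
        0 < σ * (command P u 0).2 ∧ 0 < σ * (command P u 1).2 := by
      rcases pos_and_pos_or_neg_and_neg_of_mul_pos hω with h | h
      · exact ⟨1, Or.inl rfl, by linarith, by linarith⟩
      · exact ⟨-1, Or.inr rfl, by linarith, by linarith⟩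
    classical
    obtain ⟨Θ, hΘc, hΘ⟩ := exists_two_speed_motion hWc.measurableSet hfr ha hb
    have hcos : ∀ t, Real.cos (σ * Θ t) = Real.cos (Θ t) := fun t => by
      rcases hσ with rfl | rfl <;> simp
    have hσσ : σ * σ = 1 := by rcases hσ with rfl | rfl <;> norm_num
    refine ⟨_, _, isTrajectory_pairState (Θ := fun t => σ * Θ t)
      (w := fun t => if Θ t ∈ W then 1 else 0) hL hv
      (Measurable.ite (hΘc.measurable hWc.measurableSet) measurable_const measurable_const)
      (fun t => ?_) (fun t i h => ?_) (fun t i h => ?_) fun t => ?_⟩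
    · split_ifs <;> simp
    · have := (sees_pairState_iff hL _ i).1 (h.self_of_nhdsWithin (hfree _))
      rw [hcos] at this
      exact if_pos this
    · have := mt (sees_pairState_iff hL _ i).2 (h.self_of_nhdsWithin (hfree _))
      rw [hcos] at this
      exact if_neg this
    · have h0 : Θ 0 = 0 := by rw [hΘ 0, intervalIntegral.integral_same]
      simp only [h0, mul_zero, zero_add]
      rw [hΘ t, ← intervalIntegral.integral_const_mul]
      refine intervalIntegral.integral_congr fun s _ => ?_
      split_ifs <;> rw [← mul_assoc, hσσ, one_mul]

/-! ### The two cases combined -/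

theorem theorem1 (P : RobotModel) :
    (∀ u ∈ controllers, ∃ n : ℕ, 2 ≤ n ∧ ∃ x₀ ∈ freeSpace P n,
      (∃ γ : ℝ → Fin n → RobotState, IsTrajectory P u x₀ γ) ∧
      ∀ γ : ℝ → Fin n → RobotState, IsTrajectory P u x₀ γ →
        ∀ t : ℝ, 0 ≤ t → γ t ∉ aggregated P n) ∧
    ¬ ∃ u ∈ controllers, ∀ n : ℕ, 2 ≤ n → ∀ x₀ ∈ freeSpace P n,
      ∃ γ : ℝ → Fin n → RobotState, IsTrajectory P u x₀ γ ∧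
        ∃ t : ℝ, 0 ≤ t ∧ γ t ∈ aggregated P n := by
  have main : ∀ u ∈ controllers, ∃ n : ℕ, 2 ≤ n ∧ ∃ x₀ ∈ freeSpace P n,
      (∃ γ : ℝ → Fin n → RobotState, IsTrajectory P u x₀ γ) ∧
      ∀ γ : ℝ → Fin n → RobotState, IsTrajectory P u x₀ γ →
        ∀ t : ℝ, 0 ≤ t → γ t ∉ aggregated P n := by
    intro u _
    by_cases hv : (command P u 0).1 = 0 ∧ (command P u 1).1 = 0
    · have hv' : ∀ w, (command P u w).1 = 0 := by
        have h0 := hv.1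
        have h1 := hv.2
        rw [command_fst] at h0 h1
        intro w
        rw [command_fst]
        linear_combination (1 - w) * h0 + w * h1
      have hr := P.radius_pos
      have hρ := P.padding_nonneg
      set L := 2 * P.radius + P.padding
      have hL : P.radius ≤ L := by linarith
      obtain ⟨θ, γ₀, hγ₀⟩ := exists_isTrajectory_pairState hL hv'
      refine ⟨2, le_rfl, pairState L θ, pairState_mem_freeSpace hL θ, ⟨γ₀, hγ₀⟩,
        fun γ hγ t ht => ?_⟩
      -- The speed vanishes for every weight, so the centres stay fixed along every trajectory,
      -- whatever the orientations do.
      have hpos : ∀ i, (γ t i).1 = (pairState L θ i).1 := fun i => by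
        obtain ⟨w, k, hwk⟩ := hγ.motion
        rw [(hwk i).2.2.2.1 t ht]
        simp [hv']
      refine not_mem_aggregated_of_gap P _ 0 0 (fun i => ?_) (i := 0) (j := 1) ?_ ?_
      · rw [hpos i]
        have hL' : P.radius + P.padding < |L| := by rw [abs_of_pos (by positivity)]; linarith
        fin_cases i <;> simpa [pairState] using hL'
      · rw [hpos 0]; simp [pairState]; positivity
      · rw [hpos 1]; simp [pairState]; positivity
    · obtain ⟨c, hc, hvc⟩ : ∃ c : ℝ, (c = 0 ∨ c = 1) ∧ (command P u c).1 ≠ 0 := by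
        by_cases h0 : (command P u 0).1 = 0
        · exact ⟨1, Or.inr rfl, fun h1 => hv ⟨h0, h1⟩⟩
        · exact ⟨0, Or.inl rfl, h0⟩
      obtain ⟨x₀, hfree, hagg, hconst, huniq⟩ := exists_deadlock P u hc hvc
      exact ⟨4, by norm_num, x₀, hfree, ⟨_, hconst⟩, fun γ hγ t ht => huniq γ hγ t ht ▸ hagg⟩
  refine ⟨main, fun ⟨u, hu, hall⟩ => ?_⟩
  obtain ⟨n, hn, x₀, hx₀, -, hnever⟩ := main u hu
  obtain ⟨γ, hγ, t, ht, hagg⟩ := hall n hn x₀ hx₀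
  exact hnever γ hγ t ht hagg
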